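/- Let $V$ be a vector space over a field $F$ (of any dimension, possibly infinite), with a symmetric bilinear form $\xi$ such that $\xi(v,v)=0$ only for $v=0$. Let $\mathfrak M=\langle S,\mathcal L,\perp\rangle$ be the Euclidean space it determines: $S=V$ is the set of points, $\mathcal L$ is the set of lines (translates of one-dimensional linear subspaces), and two lines are orthogonal, $L_1\perp L_2$, when their directions are $\xi$-orthogonal. Let $\dim\mathfrak M=\dim V$, and let $\mathcal H_k$ be the set of nonempty affine subspaces of dimension $k$. For points, write $a,b\perp c,d$ when there are lines $L_1\perp L_2$ with $a,b\in L_1$ and $c,d\in L_2$. For subspaces, write $X\perp Y$ when $a,b\perp c,d$ for all $a,b\in X$ and $c,d\in Y$, and write $X\perp^{\times}Y$ when $X\perp Y$ and $X\cap Y\ne\emptyset$. Let $X\sqcup Y$ be the least subspace that contains $X\cup Y$. Write $X_1\perp_g^{0}X_2$ when there are a point $q\in X_1\cap X_2$ and subspaces $Z_1,Z_2$ through $q$ such that $Z_1,Z_2\perp^{\times}X_1\cap X_2$, $Z_1\perp^{\times}Z_2$, and $(X_1\cap X_2)\sqcup Z_i=X_i$ for $i=1,2$. Write $X_1\perp_g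 X_2$ when $X_1\perp_g^{0}X_2$ and $X_1\cap X_2\ne X_1,X_2$. Finally, write $X_1\perp^{m}_{k_1,k_2}X_2$ when $X_1\perp_g X_2$, $X_1\in\mathcal H_{k_1}$, $X_2\in\mathcal H_{k_2}$ and $X_1\cap X_2\in\mathcal H_m$. Let $k_1,k_2\ge 1$ be integers. (i) If $0\le m<\min(k_1,k_2)$ is an integer and $k_1+k_2-m\le\dim\mathfrak M$, then $\mathfrak M$ is definable in the structure $\langle S,\mathcal H_{k_1},\mathcal H_{k_2},\perp^{m}_{k_1,k_2}\rangle$. (ii) If $k_1,k_2<\dim\mathfrak M$, then $\mathfrak M$ is definable in the structure $\mathfrak K=\langle S,\mathcal H_{k_1},\mathcal H_{k_2},\perp_g^{0}\cap(\mathcal H_{k_1}\times\mathcal H_{k_2})\rangle$. Here the individuals of both structures are the points and the subspaces of dimension $k_1$ or $k_2$, and the basic relations are "is a point", "is in $\mathcal H_{k_1}$", "is in $\mathcal H_{k_2}$", the incidence of points with subspaces, and the given relation of orthogonality. That $\mathfrak M$ is definable means that the set of points is definable, and that for some $n$ there are a definable set $D$ of $n$-tuples of individuals and a map $c$ from $D$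 onto $\mathcal L$ such that the relations "$p$ is a point on $c(x)$" and "$c(x)\perp c(y)$" ($x,y\in D$) are definable. Definable always means by a first-order formula without parameters. -/

import Mathlib

open scoped Cardinal

namespace OrthSub

section Geometry

variable {F V : Type*} [Field F] [AddCommGroup V] [Module F V]

/-- `X` is a `k`-dimensional (nonempty) affine subspace of `V`. The dimension is the cardinal rank
of the direction, so that infinite-dimensional subspaces are never counted as `0`-dimensional. -/
def IsDim (k : ℕ) (X : AffineSubspace F V) : Prop :=
  (X : Set V).Nonempty ∧ Module.rank F X.direction = (k : Cardinal)

/-- `X` is a line: a translate of a one-dimensional linear subspace. -/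
def IsLine (X : AffineSubspace F V) : Prop := IsDim 1 X

variable (ξ : LinearMap.BilinForm F V)

/-- The bilinear form `ξ` makes `V` a Euclidean space: it is symmetric and has no isotropic
directions (and so it is nondegenerate). -/
structure IsEuclidean : Prop where
  symm : ∀ u v : V, ξ u v = ξ v u
  anisotropic : ∀ v : V, ξ v v = 0 → v = 0

/-- Orthogonality of lines determined by `ξ`. -/
def LinePerp (L₁ L₂ : AffineSubspace F V) : Prop :=
  IsLine L₁ ∧ IsLine L₂ ∧ ∀ u ∈ L₁.direction, ∀ v ∈ L₂.direction, ξ u v = 0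

/-- Orthogonality of pairs of points: `a, b ⟂ c, d`. -/
def PointPerp (a b c d : V) : Prop :=
  ∃ L₁ L₂ : AffineSubspace F V, a ∈ L₁ ∧ b ∈ L₁ ∧ LinePerp ξ L₁ L₂ ∧ c ∈ L₂ ∧ d ∈ L₂

/-- Orthogonality of subspaces, `X ⟂ Y`. -/
def Perp (X Y : AffineSubspace F V) : Prop :=
  ∀ a ∈ X, ∀ b ∈ X, ∀ c ∈ Y, ∀ d ∈ Y, PointPerp ξ a b c d

/-- Orthogonality of subspaces that meet. -/
def PerpMeet (X Y : AffineSubspace F V) : Prop :=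
  Perp ξ X Y ∧ ((X ⊓ Y : AffineSubspace F V) : Set V).Nonempty

/-- The relation `X₁ ⟂_g° X₂`: there are a common point `q` of `X₁` and `X₂` and subspaces
`Z₁, Z₂` through `q`, orthogonal to `X₁ ∩ X₂` and to each other, such that `X₁ ∩ X₂` and `Zᵢ`
span `Xᵢ`. -/
def PerpGO (X₁ X₂ : AffineSubspace F V) : Prop :=
  ∃ q ∈ X₁ ⊓ X₂, ∃ Z₁ Z₂ : AffineSubspace F V,
    q ∈ Z₁ ∧ q ∈ Z₂ ∧ PerpMeet ξ Z₁ (X₁ ⊓ X₂) ∧ PerpMeet ξ Z₂ (X₁ ⊓ X₂) ∧ PerpMeet ξ Z₁ Z₂ ∧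
    (X₁ ⊓ X₂) ⊔ Z₁ = X₁ ∧ (X₁ ⊓ X₂) ⊔ Z₂ = X₂

/-- Generalized orthogonality `X₁ ⟂_g X₂`: inclusions are excluded. -/
def PerpG (X₁ X₂ : AffineSubspace F V) : Prop :=
  PerpGO ξ X₁ X₂ ∧ X₁ ⊓ X₂ ≠ X₁ ∧ X₁ ⊓ X₂ ≠ X₂

/-- Generalized orthogonality of a `k₁`-subspace and a `k₂`-subspace that meet in an
`m`-subspace. -/
def PerpDim (m k₁ k₂ : ℕ) (X₁ X₂ : AffineSubspace F V) : Prop :=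
  PerpG ξ X₁ X₂ ∧ IsDim k₁ X₁ ∧ IsDim k₂ X₂ ∧ IsDim m (X₁ ⊓ X₂)

end Geometry

section Structures

/-- The relation symbols of the language of points and subspaces: the sort of points, the two
families of subspaces, incidence, and orthogonality. -/
inductive SubspaceRel : ℕ → Type
  | point : SubspaceRel 1
  | sub₁ : SubspaceRel 1
  | sub₂ : SubspaceRel 1
  | inc : SubspaceRel 2
  | perp : SubspaceRel 2

/-- The (purely relational) first-order language of points and subspaces. -/
def subspaceLang : FirstOrder.Language.{0, 0} where
  Functions := fun _ => Empty
  Relations := SubspaceRel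

variable {F V : Type*} [Field F] [AddCommGroup V] [Module F V]

/-- The individuals of the structure `⟨S, H_{k₁}, H_{k₂}, R⟩`: the points of `V`, and the
subspaces of `V` that have dimension `k₁` or `k₂`. The binary relation `R` on subspaces is recorded
in the type, so that the structure can be found by instance search. -/
inductive SubspaceGeometry (k₁ k₂ : ℕ)
    (R : AffineSubspace F V → AffineSubspace F V → Prop) : Type _
  | point (p : V) : SubspaceGeometry k₁ k₂ R
  | sub (X : AffineSubspace F V) (hX : IsDim k₁ X ∨ IsDim k₂ X) : SubspaceGeometry k₁ k₂ R

namespace SubspaceGeometry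

variable {k₁ k₂ : ℕ} {R : AffineSubspace F V → AffineSubspace F V → Prop}

/-- The individual `x` is a point. -/
def IsPoint (x : SubspaceGeometry k₁ k₂ R) : Prop := ∃ p, x = point p

/-- The individual `x` is a subspace of dimension `k`. -/
def IsSub (k : ℕ) (x : SubspaceGeometry k₁ k₂ R) : Prop :=
  ∃ X hX, x = sub X hX ∧ IsDim k X

/-- The individual `x` is a point, `y` is a subspace, and `x` lies on `y`. -/
def Inc (x y : SubspaceGeometry k₁ k₂ R) : Prop :=
  ∃ p X hX, x = point p ∧ y = sub X hX ∧ p ∈ X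

/-- The individuals `x` and `y` are a `k₁`-subspace and a `k₂`-subspace that are related
by `R`. -/
def Rel (x y : SubspaceGeometry k₁ k₂ R) : Prop :=
  ∃ X hX Y hY, x = sub X hX ∧ y = sub Y hY ∧ IsDim k₁ X ∧ IsDim k₂ Y ∧ R X Y

/-- The first-order structure `⟨S, H_{k₁}, H_{k₂}, R ∩ (H_{k₁} × H_{k₂})⟩`. -/
instance : subspaceLang.Structure (SubspaceGeometry k₁ k₂ R) where
  funMap := fun f _ => Empty.elim f
  RelMap := fun r x =>
    match r, x with
    | SubspaceRel.point, x => IsPoint (x 0)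
    | SubspaceRel.sub₁, x => IsSub k₁ (x 0)
    | SubspaceRel.sub₂, x => IsSub k₂ (x 0)
    | SubspaceRel.inc, x => Inc (x 0) (x 1)
    | SubspaceRel.perp, x => Rel (x 0) (x 1)

end SubspaceGeometry

/-- The Euclidean space `⟨V, lines, ⟂⟩` of the form `ξ` is definable, without parameters, in the
first-order structure `K`, whose individuals include the points of `V` by way of `pt`:
the set of points is definable; the lines are exactly the sets coded, through a map `c`, by the
tuples in some definable set `D` of `n`-tuples of individuals; and both the incidence of a point
with the line coded by a tuple and the orthogonality of the lines coded by two tuples are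
definable. -/
def EuclideanDefinableIn (ξ : LinearMap.BilinForm F V) (𝓛 : FirstOrder.Language) (K : Type*)
    [𝓛.Structure K] (pt : V → K) : Prop :=
  (∅ : Set K).Definable₁ 𝓛 (Set.range pt) ∧
  ∃ (n : ℕ) (D : Set (Fin n → K)) (c : (Fin n → K) → AffineSubspace F V),
    (∅ : Set K).Definable 𝓛 D ∧
    c '' D = {L | IsLine L} ∧
    (∅ : Set K).Definable 𝓛 {x : Fin n ⊕ Fin 1 → K |
      x ∘ Sum.inl ∈ D ∧ ∃ p ∈ c (x ∘ Sum.inl), x (Sum.inr 0) = pt p} ∧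
    (∅ : Set K).Definable 𝓛 {x : Fin n ⊕ Fin n → K |
      x ∘ Sum.inl ∈ D ∧ x ∘ Sum.inr ∈ D ∧ LinePerp ξ (c (x ∘ Sum.inl)) (c (x ∘ Sum.inr))}

end Structures

end OrthSub

namespace OrthSub

/-! ### Subspaces of prescribed dimension and orthogonal complements. -/

section LinearAlgebra

variable {F V : Type*} [Field F] [AddCommGroup V] [Module F V]

/-! A line is coded by two distinct points, and since `k₁` is below the dimension of the space, it
is the intersection of the `k₁`-subspaces through them (`mem_affineSpan_pair_iff_forall`). What
remains is to define orthogonality of lines, and this is done through feet of perpendiculars.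

Let `X` have direction `U`, and let `q ∈ X`. The subspaces `Y` through `q` orthogonal to `X` have
direction `W ⊔ B` with `W ≤ U` and `B ≤ Uᗮ`. If `x - q ∈ Uᗮ` and `B ≠ 0`, then `B` can be exchanged
for another subspace of `Uᗮ` that contains `x - q`, without changing `X ∩ Y`. Conversely, if this
exchange is always possible, then `x - q` lies in `W ⊔ Uᗮ` for every `m`-dimensional `W ≤ U`; as `m
< k₁`, these `W` have only `0` in common, and `x - q ∈ Uᗮ`. So "`q` is the foot of `x` on `X`" is
first-order (`IsOrthogonality.sub_mem_orthogonal_iff`). Finally `ab ⟂ cd` exactly when `c` and `d`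
have the same foot on some `k₁`-subspace through `a` and `b`
(`IsEuclidean.apply_eq_zero_iff_exists`).

Both claims of the theorem are instances of one statement about relations satisfying
`IsOrthogonality`. -/

theorem rank_sup_span_singleton {T : Submodule F V} {v : V} (hv : v ∉ T) :
    Module.rank F ↥(T ⊔ F ∙ v) = Module.rank F T + 1 := by
  have hv0 : v ≠ 0 := fun h => hv (h ▸ T.zero_mem)
  have hd : Disjoint T (F ∙ v) := (Submodule.disjoint_span_singleton' hv0).2 hv
  have h := Submodule.rank_sup_add_rank_inf_eq T (F ∙ v)
  rwa [hd.eq_bot, rank_bot, add_zero, (rank_submodule_eq_one_iff _).2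
    ⟨v, Submodule.mem_span_singleton_self v, hv0, le_rfl⟩] at h

theorem finiteDimensional_of_rank_eq {U : Submodule F V} {k : ℕ} (h : Module.rank F U = k) :
    FiniteDimensional F U :=
  Module.finite_of_rank_eq_nat h

theorem exists_submodule_between {T S : Submodule F V} (hTS : T ≤ S) {t b : ℕ}
    (hT : Module.rank F T = t) (htb : t ≤ b) (hb : (b : Cardinal) ≤ Module.rank F S) :
    ∃ B : Submodule F V, T ≤ B ∧ B ≤ S ∧ Module.rank F B = b := by
  induction b, htb using Nat.le_induction with
  | base => exact ⟨T, le_rfl, hTS, hT⟩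
  | succ b _ ih =>
    obtain ⟨B, hTB, hBS, hB⟩ := ih (le_trans (by exact_mod_cast Nat.le_succ b) hb)
    have hne : ¬ S ≤ B := fun h => by
      have := hb.trans (Submodule.rank_mono h)
      rw [hB] at this
      have : b + 1 ≤ b := by exact_mod_cast this
      omega
    obtain ⟨s, hs, hsB⟩ := SetLike.not_le_iff_exists.1 hne
    refine ⟨B ⊔ F ∙ s, hTB.trans le_sup_left,
      sup_le hBS ((Submodule.span_singleton_le_iff_mem _ _).2 hs), ?_⟩
    rw [rank_sup_span_singleton hsB, hB, Nat.cast_succ]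

theorem exists_submodule_mem {S : Submodule F V} {v : V} (hv : v ∈ S) {b : ℕ} (hb1 : 1 ≤ b)
    (hb : (b : Cardinal) ≤ Module.rank F S) :
    ∃ B : Submodule F V, v ∈ B ∧ B ≤ S ∧ Module.rank F B = b := by
  by_cases hv0 : v = 0
  · obtain ⟨B, -, hBS, hB⟩ := exists_submodule_between (bot_le : ⊥ ≤ S) (t := 0) (by simp)
      (Nat.zero_le b) hb
    exact ⟨B, hv0 ▸ B.zero_mem, hBS, hB⟩
  · obtain ⟨B, hTB, hBS, hB⟩ := exists_submodule_between
      ((Submodule.span_singleton_le_iff_mem v S).2 hv) (t := 1)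
      (by rw [(rank_submodule_eq_one_iff _).2 ⟨v, Submodule.mem_span_singleton_self v, hv0, le_rfl⟩,
        Nat.cast_one]) hb1 hb
    exact ⟨B, hTB (Submodule.mem_span_singleton_self v), hBS, hB⟩

theorem exists_submodule_notMem {T U : Submodule F V} (hTU : T ≤ U) {y : V} (hyU : y ∈ U)
    (hyT : y ∉ T) {t w : ℕ} (hT : Module.rank F T = t) (htw : t ≤ w)
    (hw : ((w + 1 : ℕ) : Cardinal) ≤ Module.rank F U) :
    ∃ W : Submodule F V, T ≤ W ∧ W ≤ U ∧ y ∉ W ∧ Module.rank F W = w := by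
  have hy0 : y ≠ 0 := fun h => hyT (h ▸ T.zero_mem)
  obtain ⟨S, hTS, hS'⟩ := ((Submodule.disjoint_span_singleton' hy0).2 hyT).exists_isCompl
  have hS := hS'.symm
  have hyS : y ∉ S := (Submodule.disjoint_span_singleton' hy0).1 hS.disjoint.symm
  have hle : U ≤ S ⊓ U ⊔ F ∙ y := by
    rw [sup_comm (S ⊓ U), ← sup_inf_assoc_of_le S ((Submodule.span_singleton_le_iff_mem y U).2 hyU),
      hS.sup_eq_top, top_inf_eq]
  have hr := hw.trans (Submodule.rank_mono hle)
  rw [rank_sup_span_singleton (fun h => hyS (Submodule.mem_inf.1 h).1), Nat.cast_succ,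
    Cardinal.add_one_le_add_one_iff] at hr
  obtain ⟨W, hTW, hWS, hW⟩ := exists_submodule_between (le_inf hTS hTU) hT htw hr
  exact ⟨W, hTW, hWS.trans inf_le_right, fun h => hyS (Submodule.mem_inf.1 (hWS h)).1, hW⟩

variable {ξ : LinearMap.BilinForm F V}

theorem IsEuclidean.mem_orthogonal_comm (hξ : IsEuclidean ξ) {U : Submodule F V} {v : V} :
    v ∈ ξ.orthogonal U ↔ ∀ u ∈ U, ξ v u = 0 :=
  forall₂_congr fun u _ => by rw [hξ.symm v u]

theorem IsEuclidean.disjoint_orthogonal (hξ : IsEuclidean ξ) (U : Submodule F V) :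
    Disjoint U (ξ.orthogonal U) :=
  Submodule.disjoint_def.2 fun v hv hv' => hξ.anisotropic v (hv' v hv)

/-- Anisotropy makes `U → Dual U` injective, hence bijective for finite-dimensional `U`. The vector
of `U` representing `ξ v` is then the projection of `v`; `V` itself may be infinite-dimensional. -/
theorem IsEuclidean.isCompl_orthogonal (hξ : IsEuclidean ξ) (U : Submodule F V)
    [FiniteDimensional F U] : IsCompl U (ξ.orthogonal U) := by
  refine ⟨hξ.disjoint_orthogonal U, codisjoint_iff.2 (eq_top_iff.2 fun v _ => ?_)⟩
  let f : U →ₗ[F] Module.Dual F U := ξ.restrict U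
  have hf : Function.Injective f := (injective_iff_map_eq_zero f).2 fun u hu =>
    Subtype.ext (hξ.anisotropic u (by simpa using! LinearMap.congr_fun hu u))
  obtain ⟨u, hu⟩ := (LinearMap.injective_iff_surjective_of_finrank_eq_finrank
    Subspace.dual_finrank_eq.symm).1 hf ((ξ v).domRestrict U)
  refine Submodule.mem_sup.2 ⟨u, u.2, v - u, hξ.mem_orthogonal_comm.2 fun w hw => ?_, by abel⟩
  have := LinearMap.congr_fun hu ⟨w, hw⟩
  have h : ξ u w = ξ v w := this
  simp [h]

theorem IsEuclidean.rank_add_rank_orthogonal (hξ : IsEuclidean ξ) (U : Submodule F V)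
    [FiniteDimensional F U] :
    Module.rank F U + Module.rank F (ξ.orthogonal U) = Module.rank F V := by
  have h := Submodule.rank_sup_add_rank_inf_eq U (ξ.orthogonal U)
  rwa [(hξ.isCompl_orthogonal U).sup_eq_top, (hξ.isCompl_orthogonal U).inf_eq_bot, rank_bot,
    add_zero, rank_top, eq_comm] at h

theorem IsEuclidean.le_rank_orthogonal (hξ : IsEuclidean ξ) {U : Submodule F V} {k b : ℕ}
    (hU : Module.rank F U = k) (h : ((k + b : ℕ) : Cardinal) ≤ Module.rank F V) :
    (b : Cardinal) ≤ Module.rank F (ξ.orthogonal U) := by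
  have := finiteDimensional_of_rank_eq hU
  rw [← hξ.rank_add_rank_orthogonal U, hU, Nat.cast_add] at h
  rw [add_comm, add_comm (k : Cardinal)] at h
  exact (Cardinal.add_le_add_iff_of_lt_aleph0 Cardinal.natCast_lt_aleph0).1 h

theorem IsEuclidean.exists_orthogonal_ne_zero (hξ : IsEuclidean ξ) (hV : 2 ≤ Module.rank F V)
    (v : V) : ∃ u, u ≠ 0 ∧ ξ v u = 0 := by
  have h1 : ∃ T : Submodule F V, v ∈ T ∧ T ≤ ⊤ ∧ Module.rank F T = (1 : ℕ) :=
    exists_submodule_mem (Submodule.mem_top) le_rfl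
      (by rw [rank_top]; exact le_trans (by exact_mod_cast one_le_two) hV)
  obtain ⟨T, hvT, -, hT⟩ := h1
  have h := hξ.le_rank_orthogonal hT (b := 1) (by exact_mod_cast hV)
  have h0 : ξ.orthogonal T ≠ ⊥ := fun h0 => by
    rw [h0, rank_bot] at h
    simp at h
  obtain ⟨u, hu, hu0⟩ := Submodule.exists_mem_ne_zero_of_ne_bot h0
  exact ⟨u, hu0, hu v hvT⟩

theorem rank_sup_of_le_orthogonal (hξ : IsEuclidean ξ) {U W B : Submodule F V} (hW : W ≤ U)
    (hB : B ≤ ξ.orthogonal U) :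
    Module.rank F ↥(W ⊔ B) = Module.rank F W + Module.rank F B := by
  have h := Submodule.rank_sup_add_rank_inf_eq W B
  rwa [((hξ.disjoint_orthogonal U).mono hW hB).eq_bot, rank_bot, add_zero] at h

theorem inf_sup_of_le_orthogonal (hξ : IsEuclidean ξ) {U W B : Submodule F V} (hW : W ≤ U)
    (hB : B ≤ ξ.orthogonal U) : U ⊓ (W ⊔ B) = W := by
  rw [inf_comm, sup_inf_assoc_of_le B hW, inf_comm,
    ((hξ.disjoint_orthogonal U).mono_right hB).eq_bot, sup_bot_eq]

end LinearAlgebra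

end OrthSub

namespace OrthSub

/-! ### Affine subspaces, their orthogonality, and feet of perpendiculars. -/

section Geometry

variable {F V : Type*} [Field F] [AddCommGroup V] [Module F V] {ξ : LinearMap.BilinForm F V}

open AffineSubspace

theorem mk'_inf_mk' (q : V) (U W : Submodule F V) : mk' q U ⊓ mk' q W = mk' q (U ⊓ W) := by
  ext; simp [AffineSubspace.mem_inf_iff, mem_mk']

theorem mk'_sup_mk' (q : V) (U W : Submodule F V) : mk' q U ⊔ mk' q W = mk' q (U ⊔ W) := by
  refine ext_of_direction_eq ?_
    ⟨q, le_sup_left (a := mk' q U) (self_mem_mk' q U), self_mem_mk' q _⟩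
  simp [direction_sup (self_mem_mk' q U) (self_mem_mk' q W)]

theorem isDim_mk' {k : ℕ} {q : V} {U : Submodule F V} :
    IsDim k (mk' q U) ↔ Module.rank F U = k := by
  rw [IsDim, direction_mk']
  exact and_iff_right (mk'_nonempty q U)

theorem IsDim.unique {k l : ℕ} {X : AffineSubspace F V} (hk : IsDim k X) (hl : IsDim l X) :
    k = l := by
  exact_mod_cast hk.2.symm.trans hl.2

theorem isLine_mk'_span {a v : V} (hv : v ≠ 0) : IsLine (mk' a (F ∙ v)) :=
  isDim_mk'.2 (by
    rw [(rank_submodule_eq_one_iff _).2 ⟨v, Submodule.mem_span_singleton_self v, hv, le_rfl⟩,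
      Nat.cast_one])

theorem isLine_affineSpan_pair {a b : V} (hab : a ≠ b) : IsLine line[F, a, b] := by
  rw [← mk'_eq (left_mem_affineSpan_pair F a b), direction_affineSpan, vectorSpan_pair_rev]
  exact isLine_mk'_span (sub_ne_zero.2 hab.symm)

theorem IsLine.exists_eq_affineSpan_pair {L : AffineSubspace F V} (hL : IsLine L) :
    ∃ a b : V, a ≠ b ∧ L = line[F, a, b] := by
  obtain ⟨⟨a, ha⟩, hr⟩ := hL
  rw [Nat.cast_one, rank_submodule_eq_one_iff] at hr
  obtain ⟨v, hv, hv0, hle⟩ := hr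
  refine ⟨a, v +ᵥ a, fun h => hv0 (by simpa using h), ?_⟩
  rw [← mk'_eq (left_mem_affineSpan_pair F a (v +ᵥ a)), direction_affineSpan,
    vectorSpan_pair_rev, vadd_vsub, ← mk'_eq ha,
    le_antisymm hle ((Submodule.span_singleton_le_iff_mem v _).2 hv)]

theorem linePerp_affineSpan_pair {a b c d : V} (hab : a ≠ b) (hcd : c ≠ d) :
    LinePerp ξ line[F, a, b] line[F, c, d] ↔ ξ (b - a) (d - c) = 0 := by
  simp only [LinePerp, isLine_affineSpan_pair hab, isLine_affineSpan_pair hcd, true_and,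
    direction_affineSpan, vectorSpan_pair_rev, vsub_eq_sub]
  refine ⟨fun h => h _ (Submodule.mem_span_singleton_self _) _
    (Submodule.mem_span_singleton_self _), fun h u hu v hv => ?_⟩
  obtain ⟨s, rfl⟩ := Submodule.mem_span_singleton.1 hu
  obtain ⟨t, rfl⟩ := Submodule.mem_span_singleton.1 hv
  simp only [map_smul, LinearMap.smul_apply, h, smul_zero]

theorem mem_affineSpan_pair_iff_forall {k : ℕ} (hk : 1 ≤ k) (hkV : (k : Cardinal) < Module.rank F V)
    {a b p : V} (hab : a ≠ b) :
    p ∈ line[F, a, b] ↔ ∀ X : AffineSubspace F V, IsDim k X → a ∈ X → b ∈ X → p ∈ X := by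
  refine ⟨fun hp X _ ha hb => affineSpan_pair_le_of_mem_of_mem ha hb hp, fun h => ?_⟩
  by_contra hp
  have hline := isLine_affineSpan_pair (F := F) hab
  have hpd : p - a ∉ (line[F, a, b]).direction := fun hd =>
    hp ((vsub_right_mem_direction_iff_mem (left_mem_affineSpan_pair F a b) p).1 hd)
  obtain ⟨W, hTW, -, hpW, hW⟩ := exists_submodule_notMem le_top Submodule.mem_top hpd hline.2 hk
    (by rw [rank_top, Nat.cast_succ]; exact Cardinal.add_one_le_of_lt hkV)
  refine hpW (h (mk' a W) (isDim_mk'.2 hW) (self_mem_mk' a W) (hTW ?_))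
  exact vsub_mem_direction (right_mem_affineSpan_pair F a b) (left_mem_affineSpan_pair F a b)

theorem Perp.apply_eq_zero {X Y : AffineSubspace F V} (h : Perp ξ X Y) {q : V} (hX : q ∈ X)
    (hY : q ∈ Y) {u v : V} (hu : u ∈ X.direction) (hv : v ∈ Y.direction) : ξ u v = 0 := by
  obtain ⟨L₁, L₂, h₁, h₁', ⟨-, -, hL⟩, h₂, h₂'⟩ :=
    h q hX (u +ᵥ q) (vadd_mem_of_mem_direction hu hX) q hY (v +ᵥ q)
      (vadd_mem_of_mem_direction hv hY)
  simpa using hL _ (vsub_mem_direction h₁' h₁) _ (vsub_mem_direction h₂' h₂)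

/-- The bound on the dimension serves degenerate pairs: when `a = b` or `c = d`, genuine orthogonal
lines through the points must still be supplied. -/
theorem IsEuclidean.perp_of_orthogonal (hξ : IsEuclidean ξ) (hV : 2 ≤ Module.rank F V)
    {X Y : AffineSubspace F V} (h : ∀ u ∈ X.direction, ∀ v ∈ Y.direction, ξ u v = 0) :
    Perp ξ X Y := by
  intro a ha b hb c hc d hd
  have hab := h _ (vsub_mem_direction hb ha) _ (vsub_mem_direction hd hc)
  obtain ⟨u, v, hu, hv, hu', hv', huv⟩ : ∃ u v : V, u ≠ 0 ∧ v ≠ 0 ∧ b - a ∈ F ∙ u ∧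
      d - c ∈ F ∙ v ∧ ξ u v = 0 := by
    rcases eq_or_ne (b - a) 0 with h₁ | h₁ <;> rcases eq_or_ne (d - c) 0 with h₂ | h₂
    · obtain ⟨w, hw, -⟩ := hξ.exists_orthogonal_ne_zero hV 0
      obtain ⟨w', hw', hww'⟩ := hξ.exists_orthogonal_ne_zero hV w
      exact ⟨w, w', hw, hw', by simp [h₁], by simp [h₂], hww'⟩
    · obtain ⟨w, hw, hw'⟩ := hξ.exists_orthogonal_ne_zero hV (d - c)
      exact ⟨w, d - c, hw, h₂, by simp [h₁], Submodule.mem_span_singleton_self _,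
        by rw [hξ.symm, hw']⟩
    · obtain ⟨w, hw, hw'⟩ := hξ.exists_orthogonal_ne_zero hV (b - a)
      exact ⟨b - a, w, h₁, hw, Submodule.mem_span_singleton_self _, by simp [h₂], hw'⟩
    · exact ⟨b - a, d - c, h₁, h₂, Submodule.mem_span_singleton_self _,
        Submodule.mem_span_singleton_self _, hab⟩
  refine ⟨mk' a (F ∙ u), mk' c (F ∙ v), self_mem_mk' _ _, mem_mk'.2 hu',
    ⟨isLine_mk'_span hu, isLine_mk'_span hv, ?_⟩, self_mem_mk' _ _, mem_mk'.2 hv'⟩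
  simp only [direction_mk']
  intro x hx y hy
  obtain ⟨s, rfl⟩ := Submodule.mem_span_singleton.1 hx
  obtain ⟨t, rfl⟩ := Submodule.mem_span_singleton.1 hy
  simp [huv]

/-- The direction of `Z₂` serves as `B`: it is orthogonal to both `X ∩ Y` and `Z₁`, which together
span `X`. -/
theorem PerpGO.exists_le_orthogonal (hξ : IsEuclidean ξ) {X Y : AffineSubspace F V}
    (h : PerpGO ξ X Y) :
    ∃ B ≤ ξ.orthogonal X.direction, Y.direction = (X ⊓ Y).direction ⊔ B := by
  obtain ⟨q, hq, Z₁, Z₂, h₁, h₂, -, ⟨hM₂, -⟩, ⟨h₁₂, -⟩, hX, hY⟩ := h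
  have key : ∀ {Z : AffineSubspace F V}, q ∈ Z →
      (X ⊓ Y ⊔ Z).direction = (X ⊓ Y).direction ⊔ Z.direction := fun hZ => by
    simp [direction_sup hq hZ]
  refine ⟨Z₂.direction, fun v hv u hu => ?_, by rw [← key h₂, hY]⟩
  rw [← hX, key h₁] at hu
  obtain ⟨w, hw, z, hz, rfl⟩ := Submodule.mem_sup.1 hu
  have hw0 : ξ w v = 0 := by rw [hξ.symm]; exact hM₂.apply_eq_zero h₂ hq hv hw
  rw [map_add, LinearMap.add_apply, hw0, h₁₂.apply_eq_zero h₁ h₂ hz hv, add_zero]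

theorem IsEuclidean.perpGO_mk' (hξ : IsEuclidean ξ) (hV : 2 ≤ Module.rank F V) (q : V)
    {U W B : Submodule F V} [FiniteDimensional F U] (hW : W ≤ U) (hB : B ≤ ξ.orthogonal U) :
    PerpGO ξ (mk' q U) (mk' q (W ⊔ B)) := by
  have := Submodule.finiteDimensional_of_le hW
  have hperp : ∀ {W₁ W₂ : Submodule F V}, (∀ u ∈ W₁, ∀ v ∈ W₂, ξ u v = 0) →
      PerpMeet ξ (mk' q W₁) (mk' q W₂) := fun h =>
    ⟨hξ.perp_of_orthogonal hV (by simpa only [direction_mk'] using h),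
      q, self_mem_mk' _ _, self_mem_mk' _ _⟩
  -- `Z₁` is the orthogonal complement of `W` within `U`, and `Z₂` is `B`, both placed at `q`.
  refine ⟨q, ⟨self_mem_mk' _ _, self_mem_mk' _ _⟩, mk' q (ξ.orthogonal W ⊓ U), mk' q B,
    self_mem_mk' _ _, self_mem_mk' _ _, ?_⟩
  rw [mk'_inf_mk', inf_sup_of_le_orthogonal hξ hW hB, mk'_sup_mk', mk'_sup_mk']
  refine ⟨hperp fun u hu v hv => ?_, hperp fun u hu v hv => ?_, hperp fun u hu v hv => ?_, ?_, rfl⟩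
  · exact hξ.mem_orthogonal_comm.1 hu.1 v hv
  · exact hξ.mem_orthogonal_comm.1 (hB hu) v (hW hv)
  · exact hB hv u hu.2
  · rw [← sup_inf_assoc_of_le _ hW, (hξ.isCompl_orthogonal W).sup_eq_top, top_inf_eq]

/-- A relation between `k₁`-subspaces and `k₂`-subspaces that lies between `PerpGO` and its
restriction to the pairs that meet in an `m`-subspace, and that depends, as far as
pairs without inclusion are concerned, on the intersection only. -/
structure IsOrthogonality (ξ : LinearMap.BilinForm F V) (m k₁ k₂ : ℕ)
    (R : AffineSubspace F V → AffineSubspace F V → Prop) : Prop where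
  perpGO : ∀ {X Y}, R X Y → PerpGO ξ X Y
  of_inf_eq : ∀ {X Y Y'}, IsDim k₁ X → IsDim k₂ Y' → R X Y → ¬ Y ≤ X → PerpGO ξ X Y' →
    X ⊓ Y' = X ⊓ Y → R X Y'
  of_isDim : ∀ {X Y}, IsDim k₁ X → IsDim k₂ Y → PerpGO ξ X Y → IsDim m (X ⊓ Y) → R X Y

variable {m k₁ k₂ : ℕ} {R : AffineSubspace F V → AffineSubspace F V → Prop}

/-- The right-hand side uses only `R` and incidence, which is what makes feet of perpendiculars
definable. Subspaces `Y ≤ X` are excluded because they leave no part orthogonal to `X` to exchange.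
-/
theorem IsOrthogonality.sub_mem_orthogonal_iff (hR : IsOrthogonality ξ m k₁ k₂ R)
    (hξ : IsEuclidean ξ) (hV : 2 ≤ Module.rank F V) (hm₁ : m < k₁) (hm₂ : m < k₂)
    (hk : ((k₁ + k₂ - m : ℕ) : Cardinal) ≤ Module.rank F V) {q x : V} {X : AffineSubspace F V}
    (hX : IsDim k₁ X) (hq : q ∈ X) :
    x - q ∈ ξ.orthogonal X.direction ↔
      ∀ Y, IsDim k₂ Y → R X Y → q ∈ Y → ¬ Y ≤ X →
        ∃ Y', IsDim k₂ Y' ∧ R X Y' ∧ X ⊓ Y' = X ⊓ Y ∧ x ∈ Y' := by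
  obtain ⟨U, rfl⟩ : ∃ U, X = mk' q U := ⟨_, (mk'_eq hq).symm⟩
  rw [direction_mk']
  have hU := isDim_mk'.1 hX
  have := finiteDimensional_of_rank_eq hU
  constructor
  · intro hx Y hY hXY hqY hYX
    obtain ⟨S, rfl⟩ : ∃ S, Y = mk' q S := ⟨_, (mk'_eq hqY).symm⟩
    obtain ⟨B, hB, hS⟩ := (hR.perpGO hXY).exists_le_orthogonal hξ
    rw [mk'_inf_mk', direction_mk', direction_mk'] at hS
    rw [direction_mk'] at hB
    have hSk := isDim_mk'.1 hY
    have := finiteDimensional_of_rank_eq hSk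
    have : FiniteDimensional F B :=
      Submodule.finiteDimensional_of_le (show B ≤ S from hS ▸ le_sup_right)
    -- `B` is nonzero, so a subspace of the same dimension has room for `x - q`.
    have hB1 : 1 ≤ Module.finrank F B := by
      rw [Nat.one_le_iff_ne_zero, Ne, Submodule.finrank_eq_zero]
      rintro rfl
      exact hYX ((mk'_le_mk'_iff q).2 (by rw [hS, sup_bot_eq]; exact inf_le_left))
    obtain ⟨B', hxB', hB', hrB'⟩ := exists_submodule_mem hx hB1
      (by rw [Module.finrank_eq_rank]; exact Submodule.rank_mono hB)
    have hdim : IsDim k₂ (mk' q (U ⊓ S ⊔ B')) := by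
      rw [isDim_mk', rank_sup_of_le_orthogonal hξ inf_le_left hB', hrB', Module.finrank_eq_rank,
        ← rank_sup_of_le_orthogonal hξ inf_le_left hB, ← hS, hSk]
    have hinf : mk' q U ⊓ mk' q (U ⊓ S ⊔ B') = mk' q U ⊓ mk' q S := by
      rw [mk'_inf_mk', mk'_inf_mk', inf_sup_of_le_orthogonal hξ inf_le_left hB']
    exact ⟨_, hdim, hR.of_inf_eq hX hdim hXY hYX (hξ.perpGO_mk' hV q inf_le_left hB') hinf, hinf,
      mem_mk'.2 (Submodule.mem_sup_right hxB')⟩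
  · intro h
    have key : ∀ W ≤ U, Module.rank F W = m → x - q ∈ W ⊔ ξ.orthogonal U := by
      intro W hW hWm
      -- The bound `k₁ + k₂ - m ≤ dim V` is exactly what lets `Uᗮ` hold a subspace of dimension `k₂
      -- - m`.
      obtain ⟨B, -, hB, hBr⟩ := exists_submodule_between (bot_le : ⊥ ≤ ξ.orthogonal U) (t := 0)
        (b := k₂ - m) (by simp) (Nat.zero_le _)
        (hξ.le_rank_orthogonal hU (by rwa [← Nat.add_sub_assoc hm₂.le]))
      have hdim : IsDim k₂ (mk' q (W ⊔ B)) := by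
        rw [isDim_mk', rank_sup_of_le_orthogonal hξ hW hB, hWm, hBr, ← Nat.cast_add,
          Nat.add_sub_of_le hm₂.le]
      have hinf : mk' q U ⊓ mk' q (W ⊔ B) = mk' q W := by
        rw [mk'_inf_mk', inf_sup_of_le_orthogonal hξ hW hB]
      obtain ⟨Y', -, hXY', hinf', hxY'⟩ := h _ hdim
        (hR.of_isDim hX hdim (hξ.perpGO_mk' hV q hW hB) (hinf ▸ isDim_mk'.2 hWm))
        (self_mem_mk' _ _) fun hle => by
          rw [inf_eq_right.2 hle] at hinf
          exact hm₂.ne ((isDim_mk'.2 hWm).unique (hinf ▸ hdim))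
      obtain ⟨B', hB', hS⟩ := (hR.perpGO hXY').exists_le_orthogonal hξ
      rw [hinf', hinf, direction_mk'] at hS
      rw [direction_mk'] at hB'
      have hqY' : q ∈ Y' := by
        have : q ∈ mk' q U ⊓ Y' := by rw [hinf', hinf]; exact self_mem_mk' _ _
        exact this.2
      exact sup_le_sup_left hB' W (hS ▸ vsub_mem_direction hxY' hqY')
    obtain ⟨y, hy, z, hz, hyz⟩ := Submodule.mem_sup.1 (show x - q ∈ U ⊔ ξ.orthogonal U by
      rw [(hξ.isCompl_orthogonal U).sup_eq_top]; exact Submodule.mem_top)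
    -- The sum `U ⊕ Uᗮ` is direct, so the `U`-component `y` of `x - q` must be the one coming from
    -- `W`.
    have hyW : ∀ W ≤ U, Module.rank F W = m → y ∈ W := by
      intro W hW hWm
      obtain ⟨y', hy', z', hz', hyz'⟩ := Submodule.mem_sup.1 (key W hW hWm)
      have h0 : y - y' = z' - z := by rw [sub_eq_sub_iff_add_eq_add, hyz, add_comm, hyz']
      have : y - y' = 0 := Submodule.disjoint_def.1 (hξ.disjoint_orthogonal U) _
        (sub_mem hy (hW hy')) (h0 ▸ sub_mem hz' hz)
      rwa [sub_eq_zero.1 this]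
    suffices y = 0 by rwa [← hyz, this, zero_add]
    by_contra hy0
    obtain ⟨W, -, hWU, hyW', hWm⟩ := exists_submodule_notMem (bot_le : ⊥ ≤ U) hy
      (by simpa using hy0) (t := 0) (by simp) (Nat.zero_le m)
      (by rw [hU]; exact_mod_cast Nat.succ_le_of_lt hm₁)
    exact hyW' (hyW W hWU hWm)

/-- If `b - a ⟂ d - c`, a `k`-dimensional `U` containing `b - a` fits into the hyperplane orthogonal
to `d - c`; then `c` and `d` project to the same point of `a + U`. Conversely, `d - c` is the
difference of `d - q` and `c - q`. -/
theorem IsEuclidean.apply_eq_zero_iff_exists (hξ : IsEuclidean ξ) {k : ℕ} (hk : 1 ≤ k)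
    (hkV : (k : Cardinal) < Module.rank F V) {a b c d : V} (hcd : c ≠ d) :
    ξ (b - a) (d - c) = 0 ↔ ∃ X : AffineSubspace F V, IsDim k X ∧ a ∈ X ∧ b ∈ X ∧
      ∃ q ∈ X, c - q ∈ ξ.orthogonal X.direction ∧ d - q ∈ ξ.orthogonal X.direction := by
  constructor
  · intro h
    have hd0 : d - c ≠ 0 := sub_ne_zero.2 hcd.symm
    have hr : Module.rank F (F ∙ (d - c)) = (1 : ℕ) := by
      rw [(rank_submodule_eq_one_iff _).2
        ⟨_, Submodule.mem_span_singleton_self _, hd0, le_rfl⟩, Nat.cast_one]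
    have hba : b - a ∈ ξ.orthogonal (F ∙ (d - c)) := fun u hu => by
      obtain ⟨s, rfl⟩ := Submodule.mem_span_singleton.1 hu
      rw [map_smul, LinearMap.smul_apply, hξ.symm, h, smul_zero]
    obtain ⟨U, hbU, hUo, hU⟩ := exists_submodule_mem hba hk (hξ.le_rank_orthogonal hr (by
      rw [add_comm, Nat.cast_succ]; exact Cardinal.add_one_le_of_lt hkV))
    have := finiteDimensional_of_rank_eq hU
    obtain ⟨y, hy, z, hz, hyz⟩ := Submodule.mem_sup.1 (show c - a ∈ U ⊔ ξ.orthogonal U by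
      rw [(hξ.isCompl_orthogonal U).sup_eq_top]; exact Submodule.mem_top)
    have hcz : c - (y + a) = z := by rw [← sub_sub, sub_right_comm, ← hyz, add_sub_cancel_left]
    refine ⟨mk' a U, isDim_mk'.2 hU, self_mem_mk' _ _, mem_mk'.2 hbU, y + a,
      vadd_mem_mk' a hy, ?_⟩
    rw [direction_mk', hcz, ← sub_add_sub_cancel d c, hcz]
    refine ⟨hz, add_mem (fun u hu => ?_) hz⟩
    rw [hξ.symm]
    exact hUo hu _ (Submodule.mem_span_singleton_self _)
  · rintro ⟨X, -, ha, hb, q, -, hc, hd⟩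
    have := sub_mem hd hc
    rw [sub_sub_sub_cancel_right] at this
    exact this _ (vsub_mem_direction hb ha)

end Geometry

end OrthSub

namespace OrthSub

/-! ### Closure properties of definable sets. -/

section Definability

open FirstOrder

variable {𝓛 : Language} {K : Type*} [𝓛.Structure K] {A : Set K} {α : Type*}

theorem definable_relMap₁ {P : K → Prop} (r : 𝓛.Relations 1)
    (h : ∀ x : Fin 1 → K, Language.Structure.RelMap r x ↔ P (x 0)) (i : α) :
    A.Definable 𝓛 {x : α → K | P (x i)} := by
  refine Set.Definable.mono (A := ∅) (Set.empty_definable_iff.2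
    ⟨r.formula₁ (Language.Term.var i), ?_⟩) (Set.empty_subset _)
  ext x
  simp [Language.Formula.realize_rel₁, h]

theorem definable_relMap₂ {P : K → K → Prop} (r : 𝓛.Relations 2)
    (h : ∀ x : Fin 2 → K, Language.Structure.RelMap r x ↔ P (x 0) (x 1)) (i j : α) :
    A.Definable 𝓛 {x : α → K | P (x i) (x j)} := by
  refine Set.Definable.mono (A := ∅) (Set.empty_definable_iff.2
    ⟨r.formula₂ (Language.Term.var i) (Language.Term.var j), ?_⟩) (Set.empty_subset _)
  ext x
  simp [Language.Formula.realize_rel₂, h]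

theorem definable_ne (i j : α) : A.Definable 𝓛 {x : α → K | x i ≠ x j} := by
  refine Set.Definable.mono (A := ∅) (Set.empty_definable_iff.2
    ⟨((Language.Term.var i).equal (Language.Term.var j)).not, ?_⟩) (Set.empty_subset _)
  ext x
  simp

theorem definable_imp {P Q : (α → K) → Prop} (hP : A.Definable 𝓛 {x | P x})
    (hQ : A.Definable 𝓛 {x | Q x}) : A.Definable 𝓛 {x | P x → Q x} :=
  hP.himp hQ

theorem definable_iff {P Q : (α → K) → Prop} (hP : A.Definable 𝓛 {x | P x})
    (hQ : A.Definable 𝓛 {x | Q x}) : A.Definable 𝓛 {x | P x ↔ Q x} := by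
  simp only [iff_iff_implies_and_implies]
  exact (definable_imp hP hQ).inter (definable_imp hQ hP)

theorem definable_exists {P : (α → K) → K → Prop}
    (h : A.Definable 𝓛 {x : α ⊕ Fin 1 → K | P (fun i => x (Sum.inl i)) (x (Sum.inr 0))}) :
    A.Definable 𝓛 {x | ∃ y, P x y} := by
  convert h.image_comp_sumInl_fin 1 using 1
  ext x
  exact ⟨fun ⟨y, hy⟩ => ⟨Sum.elim x fun _ => y, hy, rfl⟩, fun ⟨z, hz, hzx⟩ => hzx ▸ ⟨_, hz⟩⟩

theorem definable_forall {P : (α → K) → K → Prop}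
    (h : A.Definable 𝓛 {x : α ⊕ Fin 1 → K | P (fun i => x (Sum.inl i)) (x (Sum.inr 0))}) :
    A.Definable 𝓛 {x | ∀ y, P x y} := by
  convert (definable_exists (P := fun x y => ¬ P x y) h.compl).compl using 1
  ext x
  simp

end Definability

/-! ### First-order definitions of collinearity, feet and orthogonality. -/

namespace SubspaceGeometry

variable {F V : Type*} [Field F] [AddCommGroup V] [Module F V] {k₁ k₂ : ℕ}
  {R : AffineSubspace F V → AffineSubspace F V → Prop} {α : Type*}

local notation "𝕂" => SubspaceGeometry k₁ k₂ R

theorem definable_isPoint (i : α) :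
    (∅ : Set 𝕂).Definable subspaceLang {x : α → 𝕂 | IsPoint (x i)} :=
  definable_relMap₁ (𝓛 := subspaceLang) SubspaceRel.point (fun _ => Iff.rfl) i

theorem definable_isSub (i : α) :
    (∅ : Set 𝕂).Definable subspaceLang {x : α → 𝕂 | IsSub k₁ (x i)} :=
  definable_relMap₁ (𝓛 := subspaceLang) SubspaceRel.sub₁ (fun _ => Iff.rfl) i

theorem definable_inc (i j : α) :
    (∅ : Set 𝕂).Definable subspaceLang {x : α → 𝕂 | Inc (x i) (x j)} :=
  definable_relMap₂ (𝓛 := subspaceLang) SubspaceRel.inc (fun _ => Iff.rfl) i j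

theorem definable_rel (i j : α) :
    (∅ : Set 𝕂).Definable subspaceLang {x : α → 𝕂 | Rel (x i) (x j)} :=
  definable_relMap₂ (𝓛 := subspaceLang) SubspaceRel.perp (fun _ => Iff.rfl) i j

/-- The point `p` lies on every `k₁`-subspace through `a` and `b`. -/
def MemJoin (a b p : 𝕂) : Prop :=
  IsPoint p ∧ ∀ X, IsSub k₁ X → Inc a X → Inc b X → Inc p X

/-- The point `q` is the foot of the perpendicular from `x` to the `k₁`-subspace `X`. -/
def IsFoot (q x X : 𝕂) : Prop :=
  Inc q X ∧ ∀ Y, Rel X Y → Inc q Y → (∃ y, Inc y Y ∧ ¬ Inc y X) →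
    ∃ Y', Rel X Y' ∧ (∀ y, Inc y X → (Inc y Y' ↔ Inc y Y)) ∧ Inc x Y'

/-- Some `k₁`-subspace through `a` and `b` carries a common foot of the perpendiculars from
`c` and `d`. -/
def PairPerp (a b c d : 𝕂) : Prop :=
  ∃ X, IsSub k₁ X ∧ Inc a X ∧ Inc b X ∧ ∃ q, IsFoot q c X ∧ IsFoot q d X

theorem definable_memJoin (i j k : α) :
    (∅ : Set 𝕂).Definable subspaceLang {x : α → 𝕂 | MemJoin (x i) (x j) (x k)} :=
  (definable_isPoint k).inter <| definable_forall <| definable_imp (definable_isSub (Sum.inr 0)) <|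
    definable_imp (definable_inc (Sum.inl i) (Sum.inr 0)) <|
    definable_imp (definable_inc (Sum.inl j) (Sum.inr 0)) (definable_inc (Sum.inl k) (Sum.inr 0))

theorem definable_isFoot (i j k : α) :
    (∅ : Set 𝕂).Definable subspaceLang {x : α → 𝕂 | IsFoot (x i) (x j) (x k)} := by
  refine (definable_inc i k).inter <| definable_forall <|
    definable_imp (definable_rel (Sum.inl k) (Sum.inr 0)) <|
    definable_imp (definable_inc (Sum.inl i) (Sum.inr 0)) <| definable_imp ?_ ?_
  · exact definable_exists <| (definable_inc (Sum.inr 0) (Sum.inl (Sum.inr 0))).inter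
      (definable_inc (Sum.inr 0) (Sum.inl (Sum.inl k))).compl
  · refine definable_exists <| (definable_rel (Sum.inl (Sum.inl k)) (Sum.inr 0)).inter <|
      Set.Definable.inter ?_ (definable_inc (Sum.inl (Sum.inl j)) (Sum.inr 0))
    exact definable_forall <|
      definable_imp (definable_inc (Sum.inr 0) (Sum.inl (Sum.inl (Sum.inl k)))) <|
      definable_iff (definable_inc (Sum.inr 0) (Sum.inl (Sum.inr 0)))
        (definable_inc (Sum.inr 0) (Sum.inl (Sum.inl (Sum.inr 0))))

theorem definable_pairPerp (i j k l : α) :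
    (∅ : Set 𝕂).Definable subspaceLang {x : α → 𝕂 | PairPerp (x i) (x j) (x k) (x l)} :=
  definable_exists <| (definable_isSub (Sum.inr 0)).inter <|
    (definable_inc (Sum.inl i) (Sum.inr 0)).inter <|
    (definable_inc (Sum.inl j) (Sum.inr 0)).inter <| definable_exists <|
    (definable_isFoot (Sum.inr 0) (Sum.inl (Sum.inl k)) (Sum.inl (Sum.inr 0))).inter
      (definable_isFoot (Sum.inr 0) (Sum.inl (Sum.inl l)) (Sum.inl (Sum.inr 0)))

@[simp]
theorem isPoint_point (p : V) : IsPoint (point p : 𝕂) := ⟨p, rfl⟩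

@[simp]
theorem inc_point_sub {p : V} {X : AffineSubspace F V} {hX : IsDim k₁ X ∨ IsDim k₂ X} :
    Inc (point p : 𝕂) (sub X hX) ↔ p ∈ X := by
  constructor
  · rintro ⟨p', X', hX', hp, hX, h⟩
    cases hp
    cases hX
    exact h
  · exact fun h => ⟨p, X, hX, rfl, rfl, h⟩

@[simp]
theorem isSub_sub {k : ℕ} {X : AffineSubspace F V} {hX : IsDim k₁ X ∨ IsDim k₂ X} :
    IsSub k (sub X hX : 𝕂) ↔ IsDim k X := by
  constructor
  · rintro ⟨X', hX', hX, h⟩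
    cases hX
    exact h
  · exact fun h => ⟨X, hX, rfl, h⟩

@[simp]
theorem rel_sub_sub {X Y : AffineSubspace F V} {hX : IsDim k₁ X ∨ IsDim k₂ X}
    {hY : IsDim k₁ Y ∨ IsDim k₂ Y} :
    Rel (sub X hX : 𝕂) (sub Y hY) ↔ IsDim k₁ X ∧ IsDim k₂ Y ∧ R X Y := by
  constructor
  · rintro ⟨X', hX', Y', hY', hX, hY, h⟩
    cases hX
    cases hY
    exact h
  · exact fun h => ⟨X, hX, Y, hY, rfl, rfl, h⟩

theorem memJoin_iff (hk₁ : 1 ≤ k₁) (hkV : (k₁ : Cardinal) < Module.rank F V) {a b p : V}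
    (hab : a ≠ b) : MemJoin (point a : 𝕂) (point b) (point p) ↔ p ∈ line[F, a, b] := by
  rw [mem_affineSpan_pair_iff_forall hk₁ hkV hab, MemJoin, and_iff_right (isPoint_point p)]
  constructor
  · intro h X hX ha hb
    simpa [hX, ha, hb] using h (sub X (Or.inl hX))
  · rintro h _ ⟨X, hX, rfl, hX'⟩ ha hb
    exact inc_point_sub.2 (h X hX' (inc_point_sub.1 ha) (inc_point_sub.1 hb))

/-- Inclusion and equality of intersections, which are not primitive, are tested on points. -/
theorem isFoot_iff {q x : V} {X : AffineSubspace F V} (hX : IsDim k₁ X) :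
    IsFoot (point q : 𝕂) (point x) (sub X (Or.inl hX)) ↔ q ∈ X ∧
      ∀ Y, IsDim k₂ Y → R X Y → q ∈ Y → ¬ Y ≤ X →
        ∃ Y', IsDim k₂ Y' ∧ R X Y' ∧ X ⊓ Y' = X ⊓ Y ∧ x ∈ Y' := by
  rw [IsFoot, inc_point_sub]
  refine and_congr_right fun _ => ⟨fun h Y hY hXY hqY hYX => ?_, ?_⟩
  · obtain ⟨y, hyY, hyX⟩ := SetLike.not_le_iff_exists.1 hYX
    obtain ⟨_, ⟨X', _, Y', hY', hX', rfl, -, hY'k, hR⟩, hinf, hx⟩ := h (sub Y (Or.inr hY))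
      (rel_sub_sub.2 ⟨hX, hY, hXY⟩) (inc_point_sub.2 hqY)
      ⟨point y, inc_point_sub.2 hyY, fun hy => hyX (inc_point_sub.1 hy)⟩
    cases hX'
    refine ⟨Y', hY'k, hR, ?_, inc_point_sub.1 hx⟩
    ext z
    simp only [AffineSubspace.mem_inf_iff]
    refine and_congr_right fun hz => ?_
    simpa using hinf (point z) (inc_point_sub.2 hz)
  · rintro h _ ⟨X', _, Y, hYd, hX', rfl, -, hY, hR⟩ hqY ⟨_, ⟨y, _, _, rfl, hYZ, hyY⟩, hyX⟩
    cases hX'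
    cases hYZ
    obtain ⟨Y', hY', hR', hinf, hx⟩ := h Y hY hR (inc_point_sub.1 hqY)
      fun hle => hyX (inc_point_sub.2 (hle hyY))
    refine ⟨sub Y' (Or.inr hY'), rel_sub_sub.2 ⟨hX, hY', hR'⟩, ?_, inc_point_sub.2 hx⟩
    rintro _ ⟨z, Z, _, rfl, hZ, hz⟩
    cases hZ
    rw [inc_point_sub, inc_point_sub]
    have := SetLike.ext_iff.1 hinf z
    simpa [AffineSubspace.mem_inf_iff, hz] using this

variable {ξ : LinearMap.BilinForm F V} {m : ℕ}

theorem pairPerp_iff (hR : IsOrthogonality ξ m k₁ k₂ R) (hξ : IsEuclidean ξ) (hk₁ : 1 ≤ k₁)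
    (hm₁ : m < k₁) (hm₂ : m < k₂) (hk : ((k₁ + k₂ - m : ℕ) : Cardinal) ≤ Module.rank F V)
    (hkV : (k₁ : Cardinal) < Module.rank F V) (hV : 2 ≤ Module.rank F V)
    {a b c d : V} (hab : a ≠ b) (hcd : c ≠ d) :
    PairPerp (point a : 𝕂) (point b) (point c) (point d) ↔
      LinePerp ξ line[F, a, b] line[F, c, d] := by
  rw [linePerp_affineSpan_pair hab hcd, hξ.apply_eq_zero_iff_exists hk₁ hkV hcd]
  constructor
  · rintro ⟨_, ⟨X, hX, rfl, hXk⟩, ha, hb, _, hc, hd⟩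
    -- The quantified foot ranges over all individuals; its incidence with `X` forces it to be a
    -- point.
    obtain ⟨⟨q, _, _, rfl, -, -⟩, -⟩ := id hc
    rw [isFoot_iff hXk] at hc hd
    exact ⟨X, hXk, inc_point_sub.1 ha, inc_point_sub.1 hb, q, hc.1,
      (hR.sub_mem_orthogonal_iff hξ hV hm₁ hm₂ hk hXk hc.1).2 hc.2,
      (hR.sub_mem_orthogonal_iff hξ hV hm₁ hm₂ hk hXk hc.1).2 hd.2⟩
  · rintro ⟨X, hX, ha, hb, q, hq, hc, hd⟩
    refine ⟨sub X (Or.inl hX), isSub_sub.2 hX, inc_point_sub.2 ha, inc_point_sub.2 hb, point q,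
      (isFoot_iff hX).2 ⟨hq, ?_⟩, (isFoot_iff hX).2 ⟨hq, ?_⟩⟩
    · exact (hR.sub_mem_orthogonal_iff hξ hV hm₁ hm₂ hk hX hq).1 hc
    · exact (hR.sub_mem_orthogonal_iff hξ hV hm₁ hm₂ hk hX hq).1 hd

/-- The line through two individuals that are points, and the empty subspace otherwise. -/
def lineThrough : 𝕂 → 𝕂 → AffineSubspace F V
  | point a, point b => line[F, a, b]
  | _, _ => ⊥

theorem euclideanDefinableIn (hR : IsOrthogonality ξ m k₁ k₂ R) (hξ : IsEuclidean ξ)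
    (hm₁ : m < k₁) (hm₂ : m < k₂) (hk : ((k₁ + k₂ - m : ℕ) : Cardinal) ≤ Module.rank F V) :
    EuclideanDefinableIn ξ subspaceLang 𝕂 point := by
  have hk₁ : 1 ≤ k₁ := by omega
  have hkV : (k₁ : Cardinal) < Module.rank F V :=
    lt_of_lt_of_le (by exact_mod_cast (by omega : k₁ < k₁ + k₂ - m)) hk
  have hV : 2 ≤ Module.rank F V :=
    le_trans (by exact_mod_cast (by omega : 2 ≤ k₁ + k₂ - m)) hk
  refine ⟨?_, 2, {x | IsPoint (x 0) ∧ IsPoint (x 1) ∧ x 0 ≠ x 1},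
    fun x => lineThrough (x 0) (x 1), ?_, ?_, ?_, ?_⟩
  · unfold Set.Definable₁
    convert definable_isPoint (k₁ := k₁) (k₂ := k₂) (R := R) (0 : Fin 1) using 1
    ext x
    exact exists_congr fun p => eq_comm
  · exact (definable_isPoint 0).inter ((definable_isPoint 1).inter (definable_ne 0 1))
  · ext L
    constructor
    · rintro ⟨x, ⟨⟨a, ha⟩, ⟨b, hb⟩, hab⟩, rfl⟩
      simp only [ha, hb]
      exact isLine_affineSpan_pair fun h => hab (by rw [ha, hb, h])
    · intro hL
      obtain ⟨a, b, hab, rfl⟩ := hL.exists_eq_affineSpan_pair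
      exact ⟨![point a, point b], ⟨⟨a, rfl⟩, ⟨b, rfl⟩, fun h => hab (by cases h; rfl)⟩, rfl⟩
  · convert (definable_isPoint (k₁ := k₁) (k₂ := k₂) (R := R)
      (Sum.inl 0 : Fin 2 ⊕ Fin 1)).inter ((definable_isPoint (Sum.inl 1)).inter
      ((definable_ne (Sum.inl 0) (Sum.inl 1)).inter
        (definable_memJoin (Sum.inl 0) (Sum.inl 1) (Sum.inr 0)))) using 1
    ext x
    simp only [Set.mem_ofPred_eq, Set.mem_inter_iff, Function.comp_apply, and_assoc]
    refine and_congr_right fun ⟨a, ha⟩ => and_congr_right fun ⟨b, hb⟩ => and_congr_right fun h => ?_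
    rw [ha, hb] at h ⊢
    have hab : a ≠ b := fun e => h (e ▸ rfl)
    constructor
    · rintro ⟨p, hp, hx⟩
      rw [hx, memJoin_iff hk₁ hkV hab]
      exact hp
    · intro hp
      obtain ⟨p, hx⟩ := hp.1
      rw [hx, memJoin_iff hk₁ hkV hab] at hp
      exact ⟨p, hp, hx⟩
  · convert (definable_isPoint (k₁ := k₁) (k₂ := k₂) (R := R)
      (Sum.inl 0 : Fin 2 ⊕ Fin 2)).inter ((definable_isPoint (Sum.inl 1)).inter
      ((definable_ne (Sum.inl 0) (Sum.inl 1)).inter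
      ((definable_isPoint (Sum.inr 0)).inter ((definable_isPoint (Sum.inr 1)).inter
      ((definable_ne (Sum.inr 0) (Sum.inr 1)).inter
        (definable_pairPerp (Sum.inl 0) (Sum.inl 1) (Sum.inr 0) (Sum.inr 1))))))) using 1
    ext x
    simp only [Set.mem_ofPred_eq, Set.mem_inter_iff, Function.comp_apply, and_assoc]
    refine and_congr_right fun ⟨a, ha⟩ => and_congr_right fun ⟨b, hb⟩ => and_congr_right fun h =>
      and_congr_right fun ⟨c, hc⟩ => and_congr_right fun ⟨d, hd⟩ => and_congr_right fun h' => ?_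
    rw [ha, hb] at h ⊢
    rw [hc, hd] at h' ⊢
    exact (pairPerp_iff hR hξ hk₁ hm₁ hm₂ hk hkV hV (fun e => h (congrArg _ e))
      fun e => h' (congrArg _ e)).symm

end SubspaceGeometry

/-! ### The two orthogonality relations of the theorem. -/

section Orthogonalities

variable {F V : Type*} [Field F] [AddCommGroup V] [Module F V] (ξ : LinearMap.BilinForm F V)
  {m k₁ k₂ : ℕ}

/-- No condition on `m` is needed, so `m` can be chosen freely when this is applied. -/
theorem isOrthogonality_perpGO : IsOrthogonality ξ m k₁ k₂ (PerpGO ξ) where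
  perpGO := id
  of_inf_eq := fun _ _ _ _ h _ => h
  of_isDim := fun _ _ h _ => h

/-- An intersection of dimension `m` smaller than `k₁` and `k₂` already rules out inclusions, so
`PerpGO` suffices there. -/
theorem isOrthogonality_perpDim (hm₁ : m < k₁) (hm₂ : m < k₂) :
    IsOrthogonality ξ m k₁ k₂ (PerpDim ξ m k₁ k₂) := by
  have key {X Y : AffineSubspace F V} (hX : IsDim k₁ X) (hY : IsDim k₂ Y) (h : PerpGO ξ X Y)
      (hm : IsDim m (X ⊓ Y)) : PerpDim ξ m k₁ k₂ X Y :=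
    ⟨⟨h, fun e => hm₁.ne ((show IsDim m X from e ▸ hm).unique hX),
      fun e => hm₂.ne ((show IsDim m Y from e ▸ hm).unique hY)⟩, hX, hY, hm⟩
  exact ⟨fun h => h.1.1, fun hX hY' h _ hG hinf => key hX hY' hG (hinf ▸ h.2.2.2), key⟩

end Orthogonalities

end OrthSub

theorem theorem1 {F V : Type*} [Field F] [AddCommGroup V] [Module F V]
    (ξ : LinearMap.BilinForm F V) (hξ : OrthSub.IsEuclidean ξ)
    (k₁ k₂ : ℕ) (hk₁ : 1 ≤ k₁) (hk₂ : 1 ≤ k₂) :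
    (∀ m : ℕ, m < k₁ → m < k₂ →
      ((k₁ + k₂ - m : ℕ) : Cardinal) ≤ Module.rank F V →
      OrthSub.EuclideanDefinableIn ξ OrthSub.subspaceLang
        (OrthSub.SubspaceGeometry k₁ k₂ (OrthSub.PerpDim ξ m k₁ k₂))
        OrthSub.SubspaceGeometry.point) ∧
    ((k₁ : Cardinal) < Module.rank F V → (k₂ : Cardinal) < Module.rank F V →
      OrthSub.EuclideanDefinableIn ξ OrthSub.subspaceLang
        (OrthSub.SubspaceGeometry k₁ k₂ (OrthSub.PerpGO ξ))
        OrthSub.SubspaceGeometry.point) := by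
  refine ⟨fun m hm₁ hm₂ hk => OrthSub.SubspaceGeometry.euclideanDefinableIn
    (OrthSub.isOrthogonality_perpDim ξ hm₁ hm₂) hξ hm₁ hm₂ hk, fun h₁ h₂ =>
    OrthSub.SubspaceGeometry.euclideanDefinableIn
      -- The largest `m` below both `k₁` and `k₂` turns the dimension bound into `max k₁ k₂ + 1 ≤
      -- dim V`; as `k₁, k₂ ≥ 1`, the subtraction does not truncate.
      (OrthSub.isOrthogonality_perpGO ξ (m := min k₁ k₂ - 1)) hξ (by omega) (by omega) ?_⟩
  rw [show k₁ + k₂ - (min k₁ k₂ - 1) = max k₁ k₂ + 1 by omega, Nat.cast_succ]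
  refine Cardinal.add_one_le_of_lt ?_
  rcases max_choice k₁ k₂ with h | h <;> rwa [h]
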